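/- Let $\mathcal F$ be the class of completely multiplicative functions $f:\mathbb N\to\mathbb C$ with $|f(n)|\le 1$ for all $n\ge 1$. For $f,g\in\mathcal F$ and real $y$ put $$\mathbb D(f,g;y)=\Bigl(\sum_{p\le y}\frac{1-\operatorname{Re}\bigl(f(p)\overline{g(p)}\bigr)}{p}\Bigr)^{1/2},$$ where $p$ runs over primes, and for $T>0$ put $$\mathcal M(f;x,T)=\min_{t\in\mathbb R,\ |t|\le T}\mathbb D(f,n^{it};x)^2 .$$ Theorem. There is an absolute constant $C>0$ such that for every $f\in\mathcal F$, every real $x\ge 2$ and every real $T$ with $0<T\le 1$, $$\Bigl|\sum_{n\le x}\frac{f(n)}{n}\Bigr|\le C\Bigl((\log x)\exp\bigl(-\mathcal M(f;x,T)\bigr)+\frac1T\Bigr).$$ -/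

import Mathlib

/-- The class `𝓕` of completely multiplicative functions bounded by `1` in absolute value.
A completely multiplicative function on the positive integers is regarded as a function on `ℕ`
by giving it the value `0` at `0`. -/
def classF : Set (ℕ →*₀ ℂ) := {f | ∀ n, ‖f n‖ ≤ 1}

/-- The function `n ↦ n ^ (i t)` for real `t`. -/
noncomputable def twist (t : ℝ) (n : ℕ) : ℂ := (n : ℂ) ^ (Complex.I * (t : ℂ))

/-- The distance `𝔻(f, g; y)`, whose square is the sum of `(1 - Re (f(p) conj g(p))) / p` over
the primes `p ≤ y`. -/
noncomputable def pretDist (f g : ℕ → ℂ) (y : ℝ) : ℝ :=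
  Real.sqrt (∑ p ∈ (Finset.Icc 1 ⌊y⌋₊).filter Nat.Prime,
    (1 - (f p * (starRingEnd ℂ) (g p)).re) / (p : ℝ))

/-- `𝓜(f; x, T)`, the minimum of `𝔻(f, n^{it}; x)^2` over real `t` with `|t| ≤ T`
(for `T ≥ 0` it is attained: see `minDistSq_isLeast`). -/
noncomputable def minDistSq (f : ℕ → ℂ) (x T : ℝ) : ℝ :=
  sInf ((fun t : ℝ => pretDist f (twist t) x ^ 2) '' {t : ℝ | |t| ≤ T})

theorem minDistSq_isLeast (f : ℕ → ℂ) (x : ℝ) {T : ℝ} (hT : 0 ≤ T) :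
    IsLeast ((fun t : ℝ => pretDist f (twist t) x ^ 2) '' {t : ℝ | |t| ≤ T})
      (minDistSq f x T) := by
  have hset : {t : ℝ | |t| ≤ T} = Set.Icc (-T) T := by
    ext t
    simp [abs_le]
  have hc : Continuous fun t : ℝ => pretDist f (twist t) x ^ 2 := by
    unfold pretDist twist
    refine (Real.continuous_sqrt.comp ?_).pow 2
    refine continuous_finsetSum _ fun p hp => ?_
    have hp0 : (p : ℂ) ≠ 0 := by
      exact_mod_cast (Finset.mem_filter.mp hp).2.ne_zero
    have h1 : Continuous fun t : ℝ => (p : ℂ) ^ (Complex.I * (t : ℂ)) :=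
      (continuous_const.mul Complex.continuous_ofReal).const_cpow (Or.inl hp0)
    exact (continuous_const.sub (Complex.continuous_re.comp
      (continuous_const.mul (Complex.continuous_conj.comp h1)))).div_const _
  unfold minDistSq
  rw [hset]
  exact (isCompact_Icc.image hc).isLeast_sInf
    ((Set.nonempty_Icc.mpr (by linarith)).image _)

/-! Put X = log x, α = 1/X, L(v) = ∑_{n ≤ e^v} f(n)/n and F(s) = ∑ f(n) n^{-s}. The plan is to bound
L(X) by a mean of |L|, the mean by a mean square, and the mean square by values of F on Re s = 1 +
α.

Since f·log = (Λf) * f, L(X)·X equals ∑_d Λ(d) f(d)/d · L(X - log d) plus ∫_0^X L. As |f(n)/n| ≤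
1/n, L moves by O(1) over unit intervals, so each L(X - log d) may be replaced by a unit average;
Chebyshev's bound then gives |L(X)| X ≪ X + ∫_0^{X+1} |L| (`norm_sum_mul_le_integral`).

By Plancherel, ∫ |L(v)|² e^{-2αv} dv is (2π)⁻¹ ∫ |F(1+α+it)/(α+it)|² dt (`LSeries_plancherel`). For
|t| ≤ T, F is bounded by its maximum there and ∫ dt/(α²+t²) = π/α. For |t| > T, |α+it|⁻² ≪ T⁻²
|1+α+it|⁻², and Plancherel for the partial sums of f itself bounds the integral by O(1/(αT²))
(`integral_norm_sum_div_sq_le`).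

The Euler product gives |F(1+α+it)| ≪ exp(∑_{p≤x} Re(f(p)p^{-it})/p) ≪ (log x) exp(-𝔻²)
(`norm_LSeries_le_log_mul_exp`). Hence the mean square of L on [0, X+1] is ≪ ((log x) e^{-𝓜} +
1/T)², and Cauchy–Schwarz finishes. -/

/-! ### Plancherel for L¹ ∩ L² and for Dirichlet series -/

open MeasureTheory FourierTransform SchwartzMap ContDiff in
/-- The `L²` Fourier transform of a function in `L¹ ∩ L²` is given by the Fourier integral. -/
theorem fourier_toLp_ae_eq {g : ℝ → ℂ} (h1 : Integrable g) (h2 : MemLp g 2) :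
    ((𝓕 (h2.toLp g) : Lp ℂ 2 (volume : Measure ℝ)) : ℝ → ℂ) =ᵐ[volume] 𝓕 g := by
  have hcont : Continuous (𝓕 g) :=
    VectorFourier.fourierIntegral_continuous Real.continuous_fourierChar
      (L := innerₗ ℝ) continuous_inner h1
  -- Both transforms are tested against smooth compactly supported φ. For either one the transform
  -- can be moved onto φ: by definition for tempered distributions, by Fubini for the integral.
  refine ae_eq_of_integral_contDiff_smul_eq ?_ hcont.locallyIntegrable ?_
  · exact (Lp.memLp _).locallyIntegrable (by norm_num)
  intro φ hφ hc
  have hc' : HasCompactSupport (Complex.ofRealCLM ∘ φ) := hc.comp_left rfl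
  have hφ' : ContDiff ℝ ∞ (Complex.ofRealCLM ∘ φ) := by fun_prop
  set Φ : 𝓢(ℝ, ℂ) := hc'.toSchwartzMap hφ' with hΦ
  have e1 := congrArg (fun D => D Φ) (Lp.fourier_toTemperedDistribution_eq (h2.toLp g))
  simp only [TemperedDistribution.fourier_apply, Lp.toTemperedDistribution_apply] at e1
  have e2 : ∫ x, (𝓕 Φ) x • g x = ∫ x, Φ x • 𝓕 g x := by
    simpa using! VectorFourier.integral_fourierIntegral_smul_eq_flip (L := innerₗ ℝ)
      Real.continuous_fourierChar continuous_inner Φ.integrable h1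
  have e3 : ∫ x, (𝓕 Φ) x • (h2.toLp g) x = ∫ x, (𝓕 Φ) x • g x := by
    refine integral_congr_ae ?_
    filter_upwards [h2.coeFn_toLp] with x hx
    rw [hx]
  calc ∫ x, φ x • (𝓕 (h2.toLp g) : Lp ℂ 2 (volume : Measure ℝ)) x
      = ∫ x, Φ x • (𝓕 (h2.toLp g) : Lp ℂ 2 (volume : Measure ℝ)) x := by simp [hΦ]
    _ = ∫ x, Φ x • 𝓕 g x := by rw [← e1, e3, e2]
    _ = ∫ x, φ x • 𝓕 g x := by simp [hΦ]

open MeasureTheory FourierTransform in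
/-- Plancherel's theorem for functions in `L¹ ∩ L²`. -/
theorem integrable_and_integral_norm_sq_fourier {g : ℝ → ℂ} (h1 : Integrable g)
    (h2 : MemLp g 2) :
    Integrable (fun ξ => ‖𝓕 g ξ‖ ^ 2) ∧ ∫ ξ, ‖𝓕 g ξ‖ ^ 2 = ∫ v, ‖g v‖ ^ 2 := by
  have hae := fourier_toLp_ae_eq h1 h2
  have hmem : MemLp (𝓕 g) 2 := (memLp_congr_ae hae).1 (Lp.memLp _)
  refine ⟨hmem.integrable_norm_pow (by norm_num), ?_⟩
  have hn : ‖(𝓕 (h2.toLp g) : Lp ℂ 2 (volume : Measure ℝ))‖ ^ 2 = ‖h2.toLp g‖ ^ 2 := by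
    rw [Lp.norm_fourier_eq]
  have key : ∀ h : Lp ℂ 2 (volume : Measure ℝ), ‖h‖ ^ 2 = ∫ x, ‖h x‖ ^ 2 := by
    intro h
    have := congrArg Complex.re (inner_self_eq_norm_sq_to_K (𝕜 := ℂ) h)
    rw [L2.inner_def] at this
    simp only [inner_self_eq_norm_sq_to_K] at this
    rw [← RCLike.ofReal_pow] at this
    have h3 : ∫ a, ((‖h a‖ : ℂ)) ^ 2 = ((∫ a, ‖h a‖ ^ 2 : ℝ) : ℂ) := by
      rw [← integral_complex_ofReal]; simp
    erw [h3] at this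
    exact this.symm
  rw [key, key] at hn
  calc ∫ ξ, ‖𝓕 g ξ‖ ^ 2
      = ∫ x, ‖(𝓕 (h2.toLp g) : Lp ℂ 2 (volume : Measure ℝ)) x‖ ^ 2 := by
        refine integral_congr_ae ?_
        filter_upwards [hae] with x hx
        rw [hx]
    _ = ∫ x, ‖(h2.toLp g) x‖ ^ 2 := hn
    _ = ∫ v, ‖g v‖ ^ 2 := by
        refine integral_congr_ae ?_
        filter_upwards [h2.coeFn_toLp] with x hx
        rw [hx]

open MeasureTheory FourierTransform Set in
/-- The Mellin–Plancherel identity for a Dirichlet series. -/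
theorem LSeries_plancherel (a : ℕ → ℂ) {c r σ : ℝ} (hr : 0 ≤ r) (hσ : r < σ)
    (hA : ∀ n : ℕ, 1 ≤ n → ‖∑ k ∈ Finset.Icc 1 n, a k‖ ≤ c * (n : ℝ) ^ r)
    (hS : LSeriesSummable a σ) :
    Integrable (fun t : ℝ => ‖LSeries a (σ + t * Complex.I) / (σ + t * Complex.I)‖ ^ 2) ∧
    IntegrableOn (fun v : ℝ => ‖∑ k ∈ Finset.Icc 1 ⌊Real.exp v⌋₊, a k‖ ^ 2 *
      Real.exp (-(2 * σ) * v)) (Ioi 0) ∧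
    ∫ t : ℝ, ‖LSeries a (σ + t * Complex.I) / (σ + t * Complex.I)‖ ^ 2 =
      2 * Real.pi * ∫ v in Ioi (0 : ℝ), ‖∑ k ∈ Finset.Icc 1 ⌊Real.exp v⌋₊, a k‖ ^ 2 *
        Real.exp (-(2 * σ) * v) := by
  set A : ℝ → ℂ := fun u => ∑ k ∈ Finset.Icc 1 ⌊u⌋₊, a k with hAdef
  have hc : 0 ≤ c := by simpa using (norm_nonneg _).trans (hA 1 le_rfl)
  have hAu : ∀ v : ℝ, 0 < v → ‖A (Real.exp v)‖ ≤ c * Real.exp (r * v) := by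
    intro v hv
    have h1 : 1 ≤ Real.exp v := Real.one_le_exp hv.le
    have hf : 1 ≤ ⌊Real.exp v⌋₊ := Nat.one_le_floor_iff _ |>.2 h1
    refine (hA _ hf).trans ?_
    rw [mul_comm r v, Real.exp_mul]
    gcongr
    exact Nat.floor_le (Real.exp_pos v).le
  have hmeas : Measurable (fun v => A (Real.exp v)) :=
    (measurable_from_nat (f := fun n : ℕ => ∑ k ∈ Finset.Icc 1 n, a k)).comp
      (Nat.measurable_floor.comp Real.measurable_exp)
  -- With u = e^v, the Mellin integral ∫_1^∞ A(u) u^{-s-1} du = F(s)/s becomes the Fourier transform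
  -- at ξ of `h` cut to v > 0, where s = σ + 2πiξ. The gap r < σ makes `h` decay exponentially,
  -- hence lie in L¹ ∩ L².
  set h : ℝ → ℂ := fun v => A (Real.exp v) * (Real.exp (-σ * v) : ℂ) with hh
  set g : ℝ → ℂ := (Ioi 0).indicator h with hg
  have hhm : Measurable h := by
    refine hmeas.mul ?_
    exact Complex.measurable_ofReal.comp (Real.measurable_exp.comp (measurable_const.mul measurable_id))
  have hhb : ∀ v ∈ Ioi (0:ℝ), ‖h v‖ ≤ c * Real.exp (-(σ - r) * v) := by
    intro v hv
    rw [hh, norm_mul, Complex.norm_real, Real.norm_of_nonneg (Real.exp_pos _).le]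
    calc _ ≤ c * Real.exp (r * v) * Real.exp (-σ * v) := by gcongr; exact hAu v hv
      _ = _ := by rw [mul_assoc, ← Real.exp_add]; ring_nf
  have hi : IntegrableOn h (Ioi 0) := by
    refine Integrable.mono' ((exp_neg_integrableOn_Ioi 0 (sub_pos.2 hσ)).const_mul c)
      hhm.aestronglyMeasurable ?_
    exact (ae_restrict_iff' measurableSet_Ioi).2 (Filter.Eventually.of_forall hhb)
  have hi2 : IntegrableOn (fun v => ‖h v‖ ^ 2) (Ioi 0) := by
    refine Integrable.mono' ((exp_neg_integrableOn_Ioi 0 (by linarith : 0 < 2 * (σ - r))).const_mul (c ^ 2))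
      (hhm.norm.pow_const 2).aestronglyMeasurable ?_
    refine (ae_restrict_iff' measurableSet_Ioi).2 (Filter.Eventually.of_forall fun v hv => ?_)
    rw [Real.norm_of_nonneg (by positivity)]
    calc _ ≤ (c * Real.exp (-(σ - r) * v)) ^ 2 := by gcongr; exact hhb v hv
      _ = _ := by rw [mul_pow, ← Real.exp_nat_mul]; push_cast; ring_nf
  have g1 : Integrable g := (integrable_indicator_iff measurableSet_Ioi).2 hi
  have gsq : (fun v => ‖g v‖ ^ 2) = (Ioi 0).indicator (fun v => ‖h v‖ ^ 2) := by
    funext v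
    by_cases hv : v ∈ Ioi (0:ℝ) <;> simp [hg, hv]
  have g2 : MemLp g 2 := by
    rw [memLp_two_iff_integrable_sq_norm g1.aestronglyMeasurable, gsq]
    exact (integrable_indicator_iff measurableSet_Ioi).2 hi2
  obtain ⟨p1, p2⟩ := integrable_and_integral_norm_sq_fourier g1 g2
  have hhsq : ∀ v, ‖h v‖ ^ 2 = ‖A (Real.exp v)‖ ^ 2 * Real.exp (-(2 * σ) * v) := by
    intro v
    rw [hh, norm_mul, Complex.norm_real, Real.norm_of_nonneg (Real.exp_pos _).le, mul_pow,
      ← Real.exp_nat_mul]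
    push_cast; ring_nf
  have hF : ∀ ξ : ℝ, 𝓕 g ξ = LSeries a (σ + (2 * Real.pi * ξ : ℝ) * Complex.I) /
      (σ + (2 * Real.pi * ξ : ℝ) * Complex.I) := by
    intro ξ
    set s : ℂ := σ + (2 * Real.pi * ξ : ℝ) * Complex.I with hs
    have hsre : s.re = σ := by simp [hs]
    have hs0 : s ≠ 0 := fun h0 => by rw [h0] at hsre; simp at hsre; linarith
    have hO : (fun n : ℕ ↦ ∑ k ∈ Finset.Icc 1 n, a k) =O[Filter.atTop] fun n ↦ (n : ℝ) ^ r := by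
      refine Asymptotics.IsBigO.of_bound c ?_
      filter_upwards [Filter.eventually_ge_atTop 1] with n hn
      refine (hA n hn).trans ?_
      gcongr
      exact le_abs_self _
    have hS' : LSeriesSummable a s := hS.of_re_le_re (by simp [hsre])
    rw [LSeries_eq_mul_integral a hr (by rw [hsre]; exact hσ) hS' hO, mul_div_cancel_left₀ _ hs0,
      Real.fourier_real_eq_integral_exp_smul]
    have := integral_comp_exp_Ioi (fun t : ℝ => A t * (t : ℂ) ^ (-(s + 1))) 0
    rw [Real.exp_zero] at this
    rw [← this, ← integral_indicator measurableSet_Ioi]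
    congr 1
    funext v
    by_cases hv : v ∈ Ioi (0:ℝ)
    · simp only [hg, hv, indicator_of_mem, hh]
      rw [smul_eq_mul, Complex.real_smul, Complex.cpow_def_of_ne_zero (by exact_mod_cast (Real.exp_pos v).ne'),
        ← Complex.ofReal_log (Real.exp_pos v).le, Real.log_exp]
      rw [Complex.ofReal_exp, Complex.ofReal_exp]
      rw [mul_left_comm, ← Complex.exp_add, mul_left_comm, ← Complex.exp_add]
      congr 2
      rw [hs]; push_cast; ring
    · simp [hg, hv]
  have hcv : ∀ G : ℝ → ℝ, ∫ ξ, G (2 * Real.pi * ξ) = (2 * Real.pi)⁻¹ * ∫ t, G t := by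
    intro G
    rw [Measure.integral_comp_mul_left, abs_of_pos (by positivity), smul_eq_mul]
  set G : ℝ → ℝ := fun t : ℝ => ‖LSeries a (σ + t * Complex.I) / (σ + t * Complex.I)‖ ^ 2 with hGdef
  have hFG : (fun ξ => ‖𝓕 g ξ‖ ^ 2) = fun ξ => G (2 * Real.pi * ξ) := by
    funext ξ; rw [hF]
  rw [hFG] at p1 p2
  refine ⟨(integrable_comp_mul_left_iff G (by positivity : (2 * Real.pi) ≠ 0)).1 p1, ?_, ?_⟩
  · simpa only [hhsq] using hi2
  · rw [hcv, gsq, integral_indicator measurableSet_Ioi] at p2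
    simp only [hhsq] at p2
    rw [← p2, mul_inv_cancel_left₀ (by positivity)]

/-! ### Chebyshev and Mertens bounds, partial summation -/

open ArithmeticFunction in
/-- Summing `h log = (Λ h) * h` for a completely multiplicative `h`. -/
theorem sum_mul_log_eq_sum_vonMangoldt (h : ℕ → ℂ) (h0 : h 0 = 0)
    (hmul : ∀ m n, h (m * n) = h m * h n) (N : ℕ) :
    ∑ n ∈ Finset.Icc 1 N, h n * (Real.log n : ℂ) =
      ∑ d ∈ Finset.Icc 1 N, (vonMangoldt d : ℂ) * h d * ∑ m ∈ Finset.Icc 1 (N / d), h m := by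
  obtain ⟨A, hA⟩ : ∃ A : ArithmeticFunction ℂ, ∀ n, A n = (vonMangoldt n : ℂ) * h n :=
    ⟨⟨fun n => (vonMangoldt n : ℂ) * h n, by simp [h0]⟩, fun _ => rfl⟩
  obtain ⟨B, hB⟩ : ∃ B : ArithmeticFunction ℂ, ∀ n, B n = h n := ⟨⟨h, h0⟩, fun _ => rfl⟩
  have key := sum_Ioc_mul_eq_sum_sum A B N
  have hI : ∀ M : ℕ, Finset.Ioc 0 M = Finset.Icc 1 M := fun M => by ext; simp; omega
  simp only [hI, mul_apply, hA, hB] at key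
  rw [← key]
  refine Finset.sum_congr rfl fun n _ => ?_
  rw [← vonMangoldt_sum, Nat.sum_divisorsAntidiagonal (fun d m => (vonMangoldt d : ℂ) * h d * h m),
    Complex.ofReal_sum, Finset.mul_sum]
  refine Finset.sum_congr rfl fun d hd => ?_
  rw [mul_assoc, ← hmul, Nat.mul_div_cancel' (Nat.dvd_of_mem_divisors hd), mul_comm]

open ArithmeticFunction in
theorem sum_vonMangoldt_le (n : ℕ) :
    ∑ k ∈ Finset.Icc 1 n, vonMangoldt k ≤ (Real.log 4 + 4) * n := by
  have h := Chebyshev.psi_le_const_mul_self (x := n) (Nat.cast_nonneg n)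
  rw [Chebyshev.psi, Nat.floor_natCast] at h
  have hI : Finset.Ioc 0 n = Finset.Icc 1 n := by ext; simp; omega
  rwa [hI] at h

open ArithmeticFunction in
/-- The upper bound in Mertens' first theorem. -/
theorem sum_vonMangoldt_div_le {x : ℝ} (hx : 1 ≤ x) :
    ∑ d ∈ Finset.Icc 1 ⌊x⌋₊, vonMangoldt d / d ≤ Real.log x + (Real.log 4 + 4) := by
  set N := ⌊x⌋₊ with hN
  have hN1 : 1 ≤ N := (Nat.one_le_floor_iff _).2 hx
  have hNpos : (0 : ℝ) < N := by exact_mod_cast hN1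
  have hNx : (N : ℝ) ≤ x := Nat.floor_le (by linarith)
  have key : ∑ n ∈ Finset.Icc 1 N, Real.log n =
      ∑ d ∈ Finset.Icc 1 N, vonMangoldt d * ((N / d : ℕ) : ℝ) := by
    -- The case h = 1 on n ≥ 1 is the factorisation of log N!; the value at 0 must vanish.
    have := sum_mul_log_eq_sum_vonMangoldt (fun n => if n = 0 then 0 else 1) (by simp)
      (by intro m n; by_cases hm : m = 0 <;> by_cases hn : n = 0 <;> simp [hm, hn]) N
    have h1 : ∀ M : ℕ, ∑ m ∈ Finset.Icc 1 M, (if m = 0 then (0:ℂ) else 1) = M := by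
      intro M
      rw [Finset.sum_congr rfl (g := fun _ => (1:ℂ))
        (fun m hm => if_neg (by have := (Finset.mem_Icc.1 hm).1; omega))]
      simp
    have h2 : ∑ n ∈ Finset.Icc 1 N, (Real.log n : ℂ) =
        ∑ d ∈ Finset.Icc 1 N, (vonMangoldt d : ℂ) * ((N / d : ℕ) : ℂ) := by
      convert this using 1
      · refine Finset.sum_congr rfl fun n hn => ?_
        rw [if_neg (by have := (Finset.mem_Icc.1 hn).1; omega), one_mul]
      · refine Finset.sum_congr rfl fun n hn => ?_
        rw [if_neg (by have := (Finset.mem_Icc.1 hn).1; omega), mul_one, h1]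
    exact_mod_cast h2
  have hlog : ∑ n ∈ Finset.Icc 1 N, Real.log n ≤ N * Real.log N := by
    calc _ ≤ ∑ n ∈ Finset.Icc 1 N, Real.log N := by
          refine Finset.sum_le_sum fun n hn => ?_
          have := Finset.mem_Icc.1 hn
          exact Real.log_le_log (by exact_mod_cast this.1) (by exact_mod_cast this.2)
      _ = _ := by simp
  -- Dropping the integer part in N/d costs at most 1 for each d, in total ψ(N), which is O(N).
  have hlow : N * ∑ d ∈ Finset.Icc 1 N, vonMangoldt d / d ≤
      ∑ d ∈ Finset.Icc 1 N, vonMangoldt d * ((N / d : ℕ) : ℝ) +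
        ∑ d ∈ Finset.Icc 1 N, vonMangoldt d := by
    rw [Finset.mul_sum, ← Finset.sum_add_distrib]
    refine Finset.sum_le_sum fun d hd => ?_
    have hd1 : 0 < d := (Finset.mem_Icc.1 hd).1
    have h1 : (N : ℝ) / d ≤ ((N / d : ℕ) : ℝ) + 1 := by
      rw [← Nat.floor_div_eq_div (K := ℝ)]
      exact (Nat.lt_floor_add_one _).le
    have h2 := vonMangoldt_nonneg (n := d)
    calc (N : ℝ) * (vonMangoldt d / d) = vonMangoldt d * (N / d) := by ring
      _ ≤ vonMangoldt d * (((N / d : ℕ) : ℝ) + 1) := by gcongr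
      _ = _ := by ring
  have h3 : N * ∑ d ∈ Finset.Icc 1 N, vonMangoldt d / d ≤
      N * (Real.log N + (Real.log 4 + 4)) := by
    calc _ ≤ _ := hlow
      _ ≤ N * Real.log N + (Real.log 4 + 4) * N :=
        add_le_add (key ▸ hlog) (sum_vonMangoldt_le N)
      _ = _ := by ring
  have h4 := le_of_mul_le_mul_left h3 hNpos
  have h5 : Real.log N ≤ Real.log x := Real.log_le_log hNpos hNx
  linarith

open MeasureTheory Set in
/-- A Dirichlet series with nonnegative coefficients whose partial sums are at most `c n`. -/
theorem tsum_mul_rpow_le (a : ℕ → ℝ) (ha : ∀ n, 0 ≤ a n) {c σ : ℝ}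
    (hA : ∀ n : ℕ, ∑ k ∈ Finset.Icc 1 n, a k ≤ c * n) (hσ : 1 < σ) :
    Summable (fun n : ℕ => a n * (n : ℝ) ^ (-σ)) ∧
      ∑' n : ℕ, a n * (n : ℝ) ^ (-σ) ≤ c * σ / (σ - 1) := by
  have hO : (fun n : ℕ ↦ ∑ k ∈ Finset.Icc 1 n, a k) =O[Filter.atTop] fun n ↦ (n : ℝ) ^ (1:ℝ) := by
    refine Asymptotics.IsBigO.of_bound c (Filter.Eventually.of_forall fun n => ?_)
    rw [Real.norm_of_nonneg (Finset.sum_nonneg fun k _ => ha k), Real.rpow_one,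
      Real.norm_of_nonneg (Nat.cast_nonneg n)]
    exact hA n
  have hσ' : (1:ℝ) < (σ : ℂ).re := by simpa using hσ
  have hS := LSeriesSummable_of_sum_norm_bigO_and_nonneg hO ha zero_le_one hσ'
  have hL := LSeries_eq_mul_integral_of_nonneg a zero_le_one hσ' hO ha
  have hterm : ∀ n : ℕ, LSeries.term (fun n => (a n : ℂ)) σ n =
      ((a n * (n : ℝ) ^ (-σ) : ℝ) : ℂ) := by
    intro n
    rcases eq_or_ne n 0 with rfl | hn
    · simp [Real.zero_rpow (by linarith : (-σ) ≠ 0)]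
    · rw [LSeries.term_of_ne_zero hn, Real.rpow_neg (Nat.cast_nonneg n)]
      push_cast
      rw [Complex.ofReal_cpow (Nat.cast_nonneg n), Complex.ofReal_natCast, div_eq_mul_inv]
  have hs : Summable (fun n : ℕ => a n * (n : ℝ) ^ (-σ)) := by
    unfold LSeriesSummable at hS
    rw [funext hterm] at hS
    exact_mod_cast hS
  refine ⟨hs, ?_⟩
  have hval : LSeries (fun n => (a n : ℂ)) σ = ((∑' n : ℕ, a n * (n : ℝ) ^ (-σ) : ℝ) : ℂ) := by
    unfold LSeries
    rw [funext hterm, Complex.ofReal_tsum]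
  have hnn : 0 ≤ ∑' n : ℕ, a n * (n : ℝ) ^ (-σ) :=
    tsum_nonneg fun n => mul_nonneg (ha n) (Real.rpow_nonneg (Nat.cast_nonneg n) _)
  have hc : 0 ≤ c := by simpa using (ha 1).trans (by simpa using hA 1)
  calc ∑' n : ℕ, a n * (n : ℝ) ^ (-σ) = ‖LSeries (fun n => (a n : ℂ)) σ‖ := by
        rw [hval, Complex.norm_real, Real.norm_of_nonneg hnn]
    _ ≤ σ * ∫ t in Ioi (1:ℝ), c * t ^ (-σ) := by
        rw [hL, norm_mul, Complex.norm_real, Real.norm_of_nonneg (by linarith)]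
        gcongr
        refine norm_integral_le_of_norm_le
          ((integrableOn_Ioi_rpow_of_lt (by linarith) one_pos).const_mul c) ?_
        refine (ae_restrict_iff' measurableSet_Ioi).2 (Filter.Eventually.of_forall fun t ht => ?_)
        have ht1 : (1:ℝ) < t := ht
        have ht0 : (0:ℝ) < t := by linarith
        rw [norm_mul, Complex.norm_cpow_eq_rpow_re_of_pos ht0, ← Complex.ofReal_sum,
          Complex.norm_real, Real.norm_of_nonneg (Finset.sum_nonneg fun k _ => ha k)]
        have e : t ^ (-σ) = t * t ^ (-(σ:ℂ) - 1 : ℂ).re := by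
          rw [show (-(σ:ℂ) - 1 : ℂ).re = -σ - 1 by simp, Real.rpow_sub ht0, Real.rpow_one,
            mul_div_cancel₀ _ ht0.ne']
        rw [e, ← mul_assoc, show -((σ:ℂ) + 1) = -(σ:ℂ) - 1 by ring]
        gcongr
        refine (hA _).trans ?_
        gcongr
        exact Nat.floor_le ht0.le
    _ = c * σ / (σ - 1) := by
        rw [integral_const_mul, integral_Ioi_rpow_of_lt (by linarith) one_pos, Real.one_rpow]
        have : σ - 1 ≠ 0 := by linarith
        have h' : -σ + 1 ≠ 0 := by intro h; apply this; linarith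
        field_simp
        ring

/-! ### Euler products and the pretentious distance -/

/-- The modulus of a Dirichlet series with completely multiplicative coefficients, in terms of its
values at primes. -/
theorem abs_log_norm_tsum_sub_le {σ : ℝ} (hσ : 1 < σ) (φ : ℕ →*₀ ℂ)
    (hφ : ∀ n, ‖φ n‖ ≤ (n : ℝ) ^ (-σ)) :
    ∃ R : ℝ, ‖∑' n, φ n‖ = Real.exp R ∧
      |R - ∑' p : Nat.Primes, (φ p).re| ≤ 2 := by
  have hone : ∀ n : ℕ, ∑ k ∈ Finset.Icc 1 n, (1:ℝ) ≤ 1 * n := by intro n; simp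
  have hs : Summable (fun n : ℕ => (n : ℝ) ^ (-σ)) := by
    simpa using (tsum_mul_rpow_le (fun _ => 1) (fun _ => zero_le_one) hone hσ).1
  obtain ⟨hs2, ht2⟩ := tsum_mul_rpow_le (fun _ => 1) (fun _ => zero_le_one) hone one_lt_two
  simp only [one_mul] at hs2 ht2
  have hsum : Summable (‖φ ·‖) := Summable.of_nonneg_of_le (fun _ => norm_nonneg _) hφ hs
  have hE := EulerProduct.exp_tsum_primes_log_eq_tsum hsum
  have hlogs : Summable fun p : Nat.Primes => -Complex.log (1 - φ p) :=
    (hsum.of_norm.clog_one_sub.neg.subtype Nat.Prime)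
  have hpr : Summable fun p : Nat.Primes => φ p := hsum.of_norm.subtype Nat.Prime
  -- `R` is the real part of the exponent in the Euler product. Since |φ(p)| ≤ 1/p ≤ 1/2, each
  -- -log(1 - φ(p)) is within p⁻² of φ(p), and the constant 2 bounds ∑ n⁻².
  refine ⟨(∑' p : Nat.Primes, -Complex.log (1 - φ p)).re, by rw [← hE, Complex.norm_exp], ?_⟩
  rw [← Complex.re_tsum hpr, ← Complex.sub_re, ← hlogs.tsum_sub hpr]
  refine (Complex.abs_re_le_norm _).trans ?_
  have hbd : ∀ p : Nat.Primes, ‖-Complex.log (1 - φ p) - φ p‖ ≤ ((p : ℕ) : ℝ) ^ (-2 : ℝ) := by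
    intro p
    have hp2 : (2:ℝ) ≤ ((p : ℕ) : ℝ) := by exact_mod_cast p.2.two_le
    have h1 : ‖φ p‖ ≤ ((p : ℕ) : ℝ) ^ (-1 : ℝ) :=
      (hφ p).trans (Real.rpow_le_rpow_of_exponent_le (by linarith) (by linarith))
    have h2 : ((p : ℕ) : ℝ) ^ (-1 : ℝ) ≤ 1 / 2 := by
      rw [Real.rpow_neg_one, one_div]
      exact inv_anti₀ two_pos hp2
    have h3 : ‖-φ p‖ < 1 := by rw [norm_neg]; linarith
    have h4 := Complex.norm_log_one_add_sub_self_le h3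
    rw [norm_neg] at h4
    have h5 : ‖-Complex.log (1 - φ p) - φ p‖ = ‖Complex.log (1 + -φ p) - -φ p‖ := by
      rw [← norm_neg]; congr 1; ring_nf
    rw [h5]
    refine h4.trans ?_
    have h6 : (1 - ‖φ p‖)⁻¹ ≤ 2 := by
      rw [inv_le_comm₀ (by linarith) two_pos]; linarith
    calc ‖φ p‖ ^ 2 * (1 - ‖φ p‖)⁻¹ / 2 ≤ ‖φ p‖ ^ 2 * 2 / 2 := by gcongr
      _ = ‖φ p‖ ^ 2 := by ring
      _ ≤ (((p : ℕ) : ℝ) ^ (-1 : ℝ)) ^ 2 := by gcongr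
      _ = _ := by rw [← Real.rpow_natCast, ← Real.rpow_mul (by linarith)]; norm_num
  have hs2p : Summable fun p : Nat.Primes => ((p : ℕ) : ℝ) ^ (-2 : ℝ) := hs2.subtype Nat.Prime
  calc ‖∑' p : Nat.Primes, (-Complex.log (1 - φ p) - φ p)‖
      ≤ ∑' p : Nat.Primes, ((p : ℕ) : ℝ) ^ (-2 : ℝ) := tsum_of_norm_bounded hs2p.hasSum hbd
    _ ≤ ∑' n : ℕ, (n : ℝ) ^ (-2 : ℝ) :=
        Summable.tsum_subtype_le _ _ (fun n => Real.rpow_nonneg (Nat.cast_nonneg n) _) hs2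
    _ ≤ 2 := by norm_num at ht2 ⊢; linarith

theorem inv_log_le_two {x : ℝ} (hx : 2 ≤ x) : 1 / Real.log x ≤ 2 := by
  have h1 : Real.log 2 ≤ Real.log x := Real.log_le_log two_pos hx
  have h2 := Real.log_two_gt_d9
  rw [div_le_iff₀ (by linarith)]
  linarith

open ArithmeticFunction in
/-- A sum over primes weighted by `p ^ (-1 - 1 / log x)` is within `O(1)` of the sum over `p ≤ x`
weighted by `1 / p`. -/
theorem abs_tsum_primes_sub_sum_le {x : ℝ} (hx : 2 ≤ x) (w : ℕ → ℝ) (hw : ∀ n, |w n| ≤ 1) :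
    |∑' p : Nat.Primes, w p * ((p : ℕ) : ℝ) ^ (-(1 + 1 / Real.log x)) -
      ∑ p ∈ (Finset.Icc 1 ⌊x⌋₊).filter Nat.Prime, w p / (p : ℝ)| ≤
      1 + 5 * (Real.log 4 + 4) := by
  set K := Real.log 4 + 4 with hK
  have hK0 : 0 ≤ K := by have := Real.log_nonneg (by norm_num : (1:ℝ) ≤ 4); linarith
  set α := 1 / Real.log x with hα
  have hlx : 0 < Real.log x := Real.log_pos (by linarith)
  have hα0 : 0 < α := by positivity
  have hα2 : α ≤ 2 := inv_log_le_two hx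
  have hαx : α * Real.log x = 1 := by rw [hα]; field_simp
  obtain ⟨hsΛ, htΛ⟩ := tsum_mul_rpow_le (fun n => vonMangoldt n) (fun n => vonMangoldt_nonneg)
    sum_vonMangoldt_le (by linarith : 1 < 1 + α)
  have hs1 : Summable (fun n : ℕ => (n : ℝ) ^ (-(1 + α))) := by
    simpa using (tsum_mul_rpow_le (fun _ => 1) (fun _ => zero_le_one) (c := 1) (by simp)
      (by linarith : 1 < 1 + α)).1
  have hsw : Summable (fun n : ℕ => w n * (n : ℝ) ^ (-(1 + α))) := by
    refine Summable.of_norm_bounded hs1 fun n => ?_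
    have h0 : 0 ≤ (n : ℝ) ^ (-(1 + α)) := Real.rpow_nonneg (Nat.cast_nonneg n) _
    rw [norm_mul, Real.norm_eq_abs, Real.norm_of_nonneg h0]
    exact mul_le_of_le_one_left h0 (hw n)
  set S := (Finset.Icc 1 ⌊x⌋₊).filter Nat.Prime with hS
  set u : ℕ → ℝ := Set.indicator {p | p.Prime} (fun n : ℕ => w n * (n : ℝ) ^ (-(1 + α))) with hu
  set v : ℕ → ℝ := fun n => if n ∈ S then w n / (n : ℝ) else 0 with hv
  set b : ℕ → ℝ := fun n => if n ∈ Finset.Icc 1 ⌊x⌋₊ then α * (vonMangoldt n / n) else 0 with hb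
  have hvs : HasSum v (∑ p ∈ S, w p / (p : ℝ)) := by
    have : HasSum v _ := hasSum_sum_of_ne_finset_zero (s := S) (fun n hn => if_neg hn)
    rwa [Finset.sum_congr rfl (fun n hn => if_pos hn)] at this
  have hbs : HasSum b (∑ n ∈ Finset.Icc 1 ⌊x⌋₊, α * (vonMangoldt n / n)) := by
    have : HasSum b _ :=
      hasSum_sum_of_ne_finset_zero (s := Finset.Icc 1 ⌊x⌋₊) (fun n hn => if_neg hn)
    rwa [Finset.sum_congr rfl (fun n hn => if_pos hn)] at this
  have hus : Summable u := hsw.indicator _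
  have e1 : ∑' p : Nat.Primes, w p * ((p : ℕ) : ℝ) ^ (-(1 + α)) = ∑' n, u n :=
    tsum_subtype {p : ℕ | p.Prime} (fun n : ℕ => w n * (n : ℝ) ^ (-(1 + α)))
  -- For p ≤ x, 1 - p^{-α} ≤ α log p, and `b` sums to O(1) by Mertens. For p > x, 1 ≤ α log p, so
  -- the tail is at most α ∑ Λ(n) n^{-1-α}, again O(1).
  have hbound : ∀ n, ‖u n - v n‖ ≤ b n + α * (vonMangoldt n * (n : ℝ) ^ (-(1 + α))) := by
    intro n
    have hΛ := vonMangoldt_nonneg (n := n)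
    have hr : 0 ≤ (n : ℝ) ^ (-(1 + α)) := Real.rpow_nonneg (Nat.cast_nonneg n) _
    have hbn : 0 ≤ b n := by simp only [hb]; split_ifs <;> positivity
    by_cases hp : n.Prime
    · have hn0 : (0:ℝ) < n := by exact_mod_cast hp.pos
      have hΛp := vonMangoldt_apply_prime hp
      have hun : u n = w n * (n : ℝ) ^ (-(1 + α)) := by simp [hu, hp]
      by_cases hnx : n ∈ Finset.Icc 1 ⌊x⌋₊
      · have hvn : v n = w n / n := by simp only [hv]; rw [if_pos]; simp [hS, hp, Finset.mem_Icc.1 hnx]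
        have hbn' : b n = α * (vonMangoldt n / n) := by simp only [hb]; rw [if_pos hnx]
        have e : (n : ℝ) ^ (-(1 + α)) = (n:ℝ)⁻¹ * Real.exp (-(α * Real.log n)) := by
          rw [neg_add, Real.rpow_add hn0, Real.rpow_neg_one, Real.rpow_def_of_pos hn0]
          ring_nf
        have h1 : 1 - α * Real.log n ≤ Real.exp (-(α * Real.log n)) := by
          have := Real.add_one_le_exp (-(α * Real.log n)); linarith
        have h2 : Real.exp (-(α * Real.log n)) ≤ 1 :=
          Real.exp_le_one_iff.2 (by rw [← hΛp, neg_nonpos]; positivity)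
        have h3 : ‖u n - v n‖ ≤ b n := by
          rw [hun, hvn, hbn', e, hΛp]
          have : w n * ((n:ℝ)⁻¹ * Real.exp (-(α * Real.log n))) - w n / n =
            w n * ((n:ℝ)⁻¹ * (Real.exp (-(α * Real.log n)) - 1)) := by ring
          rw [this, norm_mul, norm_mul, norm_inv, Real.norm_of_nonneg hn0.le,
            Real.norm_of_nonpos (by linarith : Real.exp (-(α * Real.log n)) - 1 ≤ 0), Real.norm_eq_abs]
          calc |w n| * ((n:ℝ)⁻¹ * -(Real.exp (-(α * Real.log n)) - 1))
              ≤ 1 * ((n:ℝ)⁻¹ * (α * Real.log n)) := by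
                gcongr
                · exact mul_nonneg (by positivity) (by linarith)
                · exact hw n
                · linarith
            _ = _ := by ring
        have := mul_nonneg hα0.le (mul_nonneg hΛ hr)
        linarith
      · have hvn : v n = 0 := by simp only [hv]; rw [if_neg]; simp only [hS, Finset.mem_filter]; tauto
        have hxn : x < n := by
          by_contra hle
          refine hnx (Finset.mem_Icc.2 ⟨hp.one_lt.le, Nat.le_floor (not_lt.1 hle)⟩)
        have h1 : 1 ≤ α * vonMangoldt n := by
          rw [hΛp, ← hαx]
          gcongr
        rw [hun, hvn, sub_zero, norm_mul, Real.norm_of_nonneg hr, Real.norm_eq_abs]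
        have : |w n| * (n : ℝ) ^ (-(1 + α)) ≤ (α * vonMangoldt n) * (n : ℝ) ^ (-(1 + α)) := by
          gcongr
          exact (hw n).trans h1
        linarith
    · have hun : u n = 0 := by simp [hu, hp]
      have hvn : v n = 0 := by simp [hv, hS, hp]
      rw [hun, hvn]
      simp only [sub_zero, norm_zero]
      positivity
  rw [e1, ← hvs.tsum_eq, ← hus.tsum_sub hvs.summable, ← Real.norm_eq_abs]
  have h1 : HasSum (fun n => b n + α * (vonMangoldt n * (n : ℝ) ^ (-(1 + α)))) _ :=
    hbs.add (hsΛ.hasSum.mul_left α)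
  refine (tsum_of_norm_bounded h1 hbound).trans ?_
  rw [← Finset.mul_sum]
  have h2 := sum_vonMangoldt_div_le (x := x) (by linarith)
  calc _ ≤ α * (Real.log x + K) + α * (K * (1 + α) / (1 + α - 1)) := by gcongr
    _ = 1 + α * K + K * (1 + α) := by
      rw [mul_add, hαx]
      have : 1 + α - 1 = α := by ring
      rw [this]; field_simp
    _ ≤ 1 + 5 * K := by nlinarith

/-- Mertens' upper bound for `∑ 1 / p`, in exponential form. -/
theorem exp_sum_inv_primes_le : ∃ C : ℝ, 0 < C ∧ ∀ x : ℝ, 2 ≤ x →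
    Real.exp (∑ p ∈ (Finset.Icc 1 ⌊x⌋₊).filter Nat.Prime, 1 / (p : ℝ)) ≤ C * Real.log x := by
  -- The Euler product is applied to ζ(σ) ≤ σ/(σ-1) ≤ 3 log x, as σ ≤ 3. The exponent adds the Euler
  -- product error 2 to the truncation error 1 + 5(log 4 + 4).
  refine ⟨3 * Real.exp (3 + 5 * (Real.log 4 + 4)), by positivity, fun x hx => ?_⟩
  have hlx : 0 < Real.log x := Real.log_pos (by linarith)
  have hα0 : 0 < 1 / Real.log x := by positivity
  have hα2 := inv_log_le_two hx
  set σ := 1 + 1 / Real.log x with hσ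
  have hσ1 : 1 < σ := by linarith
  have hσ0 : ((σ : ℂ)) ≠ 0 := by exact_mod_cast (by linarith : σ ≠ 0)
  have hval : ∀ n : ℕ, riemannZetaSummandHom hσ0 n = (((n : ℝ) ^ (-σ) : ℝ) : ℂ) := by
    intro n
    simp only [riemannZetaSummandHom, MonoidWithZeroHom.coe_mk, ZeroHom.coe_mk]
    rw [Complex.ofReal_cpow (Nat.cast_nonneg n)]
    push_cast; rfl
  obtain ⟨R, hR, hR2⟩ := abs_log_norm_tsum_sub_le hσ1 (riemannZetaSummandHom hσ0) (fun n => by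
    rw [hval, Complex.norm_real, Real.norm_of_nonneg (Real.rpow_nonneg (Nat.cast_nonneg n) _)])
  have h1 := abs_tsum_primes_sub_sum_le hx (fun _ => 1) (by simp)
  simp only [hval, Complex.ofReal_re, ← Complex.ofReal_tsum, Complex.norm_real] at hR hR2
  simp only [one_mul] at h1
  have h2 := (tsum_mul_rpow_le (fun _ => 1) (fun _ => zero_le_one) (c := 1) (by simp) hσ1).2
  simp only [one_mul] at h2
  rw [Real.norm_of_nonneg (tsum_nonneg fun n => Real.rpow_nonneg (Nat.cast_nonneg n) _)] at hR
  have h3 : σ / (σ - 1) ≤ 3 * Real.log x := by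
    have : σ - 1 = 1 / Real.log x := by rw [hσ]; ring
    rw [this, div_div_eq_mul_div, div_one]
    gcongr
    linarith
  have h4 := abs_le.1 hR2
  have h5 := abs_le.1 h1
  calc _ ≤ Real.exp (R + (3 + 5 * (Real.log 4 + 4))) := Real.exp_le_exp.2 (by linarith)
    _ = Real.exp R * Real.exp (3 + 5 * (Real.log 4 + 4)) := Real.exp_add _ _
    _ ≤ (3 * Real.log x) * Real.exp (3 + 5 * (Real.log 4 + 4)) := by
      gcongr
      rw [← hR]; exact h2.trans h3
    _ = _ := by ring

/-- `Real.sqrt` vanishes on negative reals, so squaring it away needs nonnegative terms, which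
|f(p)| ≤ 1 supplies. -/
theorem pretDist_sq {f : ℕ →*₀ ℂ} (hf : f ∈ classF) (t x : ℝ) :
    pretDist (fun n => f n) (twist t) x ^ 2 =
      ∑ p ∈ (Finset.Icc 1 ⌊x⌋₊).filter Nat.Prime,
        (1 - (f p * (starRingEnd ℂ) (twist t p)).re) / (p : ℝ) := by
  unfold pretDist
  refine Real.sq_sqrt (Finset.sum_nonneg fun p hp => div_nonneg ?_ (Nat.cast_nonneg p))
  have hp0 := (Finset.mem_filter.1 hp).2.pos
  have h1 : ‖twist t p‖ = 1 := by
    unfold twist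
    rw [Complex.norm_natCast_cpow_of_pos hp0]
    simp
  have h2 : ‖f p * (starRingEnd ℂ) (twist t p)‖ ≤ 1 := by
    rw [norm_mul, RCLike.norm_conj, h1, mul_one]
    exact hf p
  linarith [(Complex.re_le_norm _).trans h2]

/-- On the line `Re s = 1 + 1 / log x` the Dirichlet series of `f` is controlled by the distance
from `f` to `n ^ (i t)`. -/
theorem norm_LSeries_le_log_mul_exp : ∃ C : ℝ, 0 < C ∧ ∀ f : ℕ →*₀ ℂ, f ∈ classF →
    ∀ x : ℝ, 2 ≤ x → ∀ t : ℝ,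
      ‖LSeries (fun n => f n) ((1 + 1 / Real.log x : ℝ) + t * Complex.I)‖ ≤
        C * (Real.log x * Real.exp (-pretDist (fun n => f n) (twist t) x ^ 2)) := by
  obtain ⟨C, hC, hCx⟩ := exp_sum_inv_primes_le
  refine ⟨Real.exp (3 + 5 * (Real.log 4 + 4)) * C, by positivity, fun f hf x hx t => ?_⟩
  have hlx : 0 < Real.log x := Real.log_pos (by linarith)
  have hα0 : 0 < 1 / Real.log x := by positivity
  set σ := 1 + 1 / Real.log x with hσ
  have hσ1 : 1 < σ := by linarith
  set s : ℂ := σ + t * Complex.I with hs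
  have hsre : s.re = σ := by simp [hs]
  have hs0 : s ≠ 0 := fun h0 => by rw [h0] at hsre; simp at hsre; linarith
  set φ : ℕ →*₀ ℂ := f * riemannZetaSummandHom hs0 with hφ
  have hφn : ∀ n, φ n = f n * (n : ℂ) ^ (-s) := fun n => rfl
  have hFn : LSeries (fun n => f n) s = ∑' n, φ n := by
    unfold LSeries
    congr 1; funext n
    rcases eq_or_ne n 0 with rfl | hn
    · simp
    · rw [LSeries.term_of_ne_zero hn, hφn, Complex.cpow_neg, div_eq_mul_inv]
  have hφb : ∀ n, ‖φ n‖ ≤ (n : ℝ) ^ (-σ) := by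
    intro n
    rcases Nat.eq_zero_or_pos n with rfl | hn
    · rw [map_zero, norm_zero]; exact Real.rpow_nonneg (Nat.cast_nonneg _) _
    · rw [hφn, norm_mul, Complex.norm_natCast_cpow_of_pos hn, Complex.neg_re, hsre]
      exact mul_le_of_le_one_left (Real.rpow_nonneg (Nat.cast_nonneg n) _) (hf n)
  obtain ⟨R, hR, hR2⟩ := abs_log_norm_tsum_sub_le hσ1 φ hφb
  set w : ℕ → ℝ := fun n => (f n * (starRingEnd ℂ) (twist t n)).re with hw
  have htw : ∀ n : ℕ, 0 < n → ‖twist t n‖ = 1 := by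
    intro n hn
    unfold twist
    rw [Complex.norm_natCast_cpow_of_pos hn]
    simp
  have hw1 : ∀ n, |w n| ≤ 1 := by
    intro n
    rcases Nat.eq_zero_or_pos n with rfl | hn
    · simp [hw]
    · refine (Complex.abs_re_le_norm _).trans ?_
      rw [norm_mul, RCLike.norm_conj, htw n hn, mul_one]
      exact hf n
  have hre : ∀ n : ℕ, 0 < n → (φ n).re = w n * (n : ℝ) ^ (-σ) := by
    intro n hn
    have hn0 : (n : ℂ) ≠ 0 := by exact_mod_cast hn.ne'
    -- Splitting off the conjugate of n^{it} makes Re(f(p) p^{-s}) the weight of the distance times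
    -- p^{-σ}.
    have e : (n : ℂ) ^ (-s) = (starRingEnd ℂ) (twist t n) * (((n : ℝ) ^ (-σ) : ℝ) : ℂ) := by
      unfold twist
      rw [Complex.ofReal_cpow (Nat.cast_nonneg n), Complex.ofReal_natCast,
        Complex.cpow_def_of_ne_zero hn0, Complex.cpow_def_of_ne_zero hn0,
        Complex.cpow_def_of_ne_zero hn0, ← Complex.exp_conj, ← Complex.exp_add,
        ← Complex.natCast_log]
      congr 1
      simp only [map_mul, Complex.conj_ofReal, Complex.conj_I, hs]
      push_cast
      ring
    rw [hφn, e, ← mul_assoc, Complex.re_mul_ofReal]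
  have h1 := abs_tsum_primes_sub_sum_le hx w hw1
  have e1 : ∑' p : Nat.Primes, (φ p).re = ∑' p : Nat.Primes, w p * ((p : ℕ) : ℝ) ^ (-σ) :=
    tsum_congr fun p => hre p p.2.pos
  rw [e1] at hR2
  have h4 := abs_le.1 hR2
  have h5 := abs_le.1 h1
  have h6 : ∑ p ∈ (Finset.Icc 1 ⌊x⌋₊).filter Nat.Prime, w p / (p : ℝ) =
      ∑ p ∈ (Finset.Icc 1 ⌊x⌋₊).filter Nat.Prime, 1 / (p : ℝ) +
        -pretDist (fun n => f n) (twist t) x ^ 2 := by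
    rw [pretDist_sq hf, ← sub_eq_add_neg, ← Finset.sum_sub_distrib]
    refine Finset.sum_congr rfl fun p _ => ?_
    simp only [hw]; ring
  rw [hFn, hR]
  calc Real.exp R ≤ Real.exp ((3 + 5 * (Real.log 4 + 4)) +
        (∑ p ∈ (Finset.Icc 1 ⌊x⌋₊).filter Nat.Prime, 1 / (p : ℝ) +
        -pretDist (fun n => f n) (twist t) x ^ 2)) := Real.exp_le_exp.2 (by linarith)
    _ = Real.exp (3 + 5 * (Real.log 4 + 4)) *
        (Real.exp (∑ p ∈ (Finset.Icc 1 ⌊x⌋₊).filter Nat.Prime, 1 / (p : ℝ)) *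
          Real.exp (-pretDist (fun n => f n) (twist t) x ^ 2)) := by
        rw [← Real.exp_add, ← Real.exp_add]
    _ ≤ Real.exp (3 + 5 * (Real.log 4 + 4)) * (C * Real.log x *
          Real.exp (-pretDist (fun n => f n) (twist t) x ^ 2)) := by
        gcongr
        exact hCx x hx
    _ = _ := by ring

/-! ### Logarithmic partial sums and their averages -/

-- X - log n is the length of the set of v in [0, X] with n ≤ e^v; sum and integral are then
-- exchanged.
open MeasureTheory Set in
theorem sum_mul_sub_log_eq_integral (h : ℕ → ℂ) (X : ℝ) :
    ∑ n ∈ Finset.Icc 1 ⌊Real.exp X⌋₊, h n * ((X - Real.log n : ℝ) : ℂ) =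
      ∫ v in Icc 0 X, ∑ n ∈ Finset.Icc 1 ⌊Real.exp v⌋₊, h n := by
  have e1 : ∀ v ∈ Icc 0 X, ∑ n ∈ Finset.Icc 1 ⌊Real.exp v⌋₊, h n =
      ∑ n ∈ Finset.Icc 1 ⌊Real.exp X⌋₊, (Ici (Real.log n)).indicator (fun _ => h n) v := by
    intro v hv
    have hsub : Finset.Icc 1 ⌊Real.exp v⌋₊ ⊆ Finset.Icc 1 ⌊Real.exp X⌋₊ :=
      Finset.Icc_subset_Icc_right (Nat.floor_mono (Real.exp_le_exp.2 hv.2))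
    have hiff : ∀ n : ℕ, 1 ≤ n → (n ≤ ⌊Real.exp v⌋₊ ↔ Real.log n ≤ v) := by
      intro n hn
      rw [Nat.le_floor_iff (Real.exp_pos v).le, Real.log_le_iff_le_exp (by exact_mod_cast hn)]
    rw [← Finset.sum_subset hsub]
    · refine Finset.sum_congr rfl fun n hn => ?_
      have := Finset.mem_Icc.1 hn
      rw [indicator_of_mem]
      exact (hiff n this.1).1 this.2
    · intro n hn hn'
      have h1 := (Finset.mem_Icc.1 hn).1
      refine indicator_of_notMem (fun hm => hn' (Finset.mem_Icc.2 ⟨h1, (hiff n h1).2 hm⟩)) _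
  rw [setIntegral_congr_fun measurableSet_Icc e1, integral_finsetSum]
  · refine Finset.sum_congr rfl fun n hn => ?_
    have hn' := Finset.mem_Icc.1 hn
    have hl0 : 0 ≤ Real.log n := Real.log_natCast_nonneg n
    have hlX : Real.log n ≤ X := by
      rw [Real.log_le_iff_le_exp (by exact_mod_cast hn'.1), ← Nat.le_floor_iff (Real.exp_pos X).le]
      exact hn'.2
    have hset : Icc 0 X ∩ Ici (Real.log n) = Icc (Real.log n) X := by
      ext v; simp only [mem_inter_iff, mem_Icc, mem_Ici]
      constructor
      · rintro ⟨⟨_, h2⟩, h3⟩; exact ⟨h3, h2⟩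
      · rintro ⟨h1, h2⟩; exact ⟨⟨hl0.trans h1, h2⟩, h1⟩
    rw [setIntegral_indicator measurableSet_Ici, hset, setIntegral_const, Real.volume_real_Icc_of_le hlX,
      Complex.real_smul, mul_comm]
  · intro n _
    exact (integrable_const (h n)).indicator measurableSet_Ici

/-- Between e^Y and e^v there are at most e^v terms, each at most e^{-Y}, contributing at most e <
3. This lets a point value be replaced by a unit average. -/
theorem norm_sum_Icc_sub_le {h : ℕ → ℂ} (hb : ∀ n, ‖h n‖ ≤ 1 / n) {Y v : ℝ} (hYv : Y ≤ v)
    (hvY : v ≤ Y + 1) :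
    ‖∑ n ∈ Finset.Icc 1 ⌊Real.exp Y⌋₊, h n‖ ≤ 3 + ‖∑ n ∈ Finset.Icc 1 ⌊Real.exp v⌋₊, h n‖ := by
  have hfl : ⌊Real.exp Y⌋₊ ≤ ⌊Real.exp v⌋₊ := Nat.floor_mono (Real.exp_le_exp.2 hYv)
  have hsub := Finset.Icc_subset_Icc_right (a := 1) hfl
  rw [← Finset.sum_sdiff hsub]
  have hd : ‖∑ n ∈ Finset.Icc 1 ⌊Real.exp v⌋₊ \ Finset.Icc 1 ⌊Real.exp Y⌋₊, h n‖ ≤ 3 := by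
    have h1 : ∀ n ∈ Finset.Icc 1 ⌊Real.exp v⌋₊ \ Finset.Icc 1 ⌊Real.exp Y⌋₊,
        ‖h n‖ ≤ Real.exp (-Y) := by
      intro n hn
      simp only [Finset.mem_sdiff, Finset.mem_Icc, not_and, not_le] at hn
      have h2 : Real.exp Y < n := (Nat.floor_lt (Real.exp_pos Y).le).1 (hn.2 hn.1.1)
      refine (hb n).trans ?_
      rw [Real.exp_neg, one_div]
      exact inv_anti₀ (Real.exp_pos Y) h2.le
    refine (norm_sum_le_of_le _ h1).trans ?_
    rw [Finset.sum_const, nsmul_eq_mul]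
    calc _ ≤ Real.exp v * Real.exp (-Y) := by
          gcongr
          refine le_trans ?_ (Nat.floor_le (Real.exp_pos v).le)
          exact_mod_cast (Finset.card_le_card Finset.sdiff_subset).trans (by simp)
      _ = Real.exp (v - Y) := by rw [← Real.exp_add, sub_eq_add_neg]
      _ ≤ Real.exp 1 := Real.exp_le_exp.2 (by linarith)
      _ ≤ 3 := Real.exp_one_lt_three.le
  set D := ∑ n ∈ Finset.Icc 1 ⌊Real.exp v⌋₊ \ Finset.Icc 1 ⌊Real.exp Y⌋₊, h n
  set E := ∑ n ∈ Finset.Icc 1 ⌊Real.exp Y⌋₊, h n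
  calc ‖E‖ = ‖(D + E) - D‖ := by rw [add_sub_cancel_left]
    _ ≤ ‖D + E‖ + ‖D‖ := norm_sub_le _ _
    _ ≤ _ := by linarith

theorem measurable_sum_Icc_floor_exp (h : ℕ → ℂ) :
    Measurable fun v : ℝ => ∑ n ∈ Finset.Icc 1 ⌊Real.exp v⌋₊, h n :=
  (measurable_from_nat (f := fun n : ℕ => ∑ k ∈ Finset.Icc 1 n, h k)).comp
    (Nat.measurable_floor.comp Real.measurable_exp)

open MeasureTheory Set in
theorem integrableOn_norm_sum_pow (h : ℕ → ℂ) (Y : ℝ) (k : ℕ) :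
    IntegrableOn (fun v : ℝ => ‖∑ n ∈ Finset.Icc 1 ⌊Real.exp v⌋₊, h n‖ ^ k) (Icc 0 Y) := by
  refine Integrable.mono' (g := fun _ => (∑ n ∈ Finset.Icc 1 ⌊Real.exp Y⌋₊, ‖h n‖) ^ k)
    (integrable_const _) ((measurable_sum_Icc_floor_exp h).norm.pow_const k).aestronglyMeasurable ?_
  refine (ae_restrict_iff' measurableSet_Icc).2 (Filter.Eventually.of_forall fun v hv => ?_)
  rw [norm_pow, norm_norm]
  gcongr
  refine (norm_sum_le _ _).trans ?_
  refine Finset.sum_le_sum_of_subset_of_nonneg ?_ fun _ _ _ => norm_nonneg _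
  exact Finset.Icc_subset_Icc_right (Nat.floor_mono (Real.exp_le_exp.2 hv.2))

-- For fixed v only d in [e^{X-v}, e^{X-v+1}] contribute. There 1/d ≤ e^{v-X}, and Chebyshev at the
-- upper endpoint gives a bound uniform in v, X and N.
open ArithmeticFunction in
theorem sum_vonMangoldt_div_indicator_le (N : ℕ) (X v : ℝ) :
    ∑ d ∈ Finset.Icc 1 N, vonMangoldt d / d *
      (Set.Icc (X - Real.log d) (X - Real.log d + 1)).indicator (fun _ => (1:ℝ)) v ≤
      3 * (Real.log 4 + 4) := by
  set Z := X - v + 1 with hZ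
  have hK0 : 0 ≤ Real.log 4 + 4 := by
    have := Real.log_nonneg (by norm_num : (1:ℝ) ≤ 4); linarith
  have h1 : ∀ d ∈ Finset.Icc 1 N, vonMangoldt d / d *
      (Set.Icc (X - Real.log d) (X - Real.log d + 1)).indicator (fun _ => (1:ℝ)) v ≤
      if d ∈ Finset.Icc 1 ⌊Real.exp Z⌋₊ then vonMangoldt d * Real.exp (1 - Z) else 0 := by
    intro d hd
    have hd1 := (Finset.mem_Icc.1 hd).1
    have hd0 : (0:ℝ) < d := by exact_mod_cast hd1
    have hΛ := vonMangoldt_nonneg (n := d)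
    by_cases hv : v ∈ Set.Icc (X - Real.log d) (X - Real.log d + 1)
    · rw [Set.indicator_of_mem hv, mul_one, if_pos, div_eq_mul_inv]
      · gcongr
        rw [← Real.exp_log hd0, ← Real.exp_neg]
        refine Real.exp_le_exp.2 ?_
        linarith [hv.1]
      · refine Finset.mem_Icc.2 ⟨hd1, Nat.le_floor ?_⟩
        rw [← Real.log_le_iff_le_exp hd0]
        linarith [hv.2]
    · rw [Set.indicator_of_notMem hv, mul_zero]
      split_ifs <;> positivity
  refine (Finset.sum_le_sum h1).trans ?_
  rw [← Finset.sum_filter]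
  calc _ ≤ ∑ d ∈ Finset.Icc 1 ⌊Real.exp Z⌋₊, vonMangoldt d * Real.exp (1 - Z) := by
        refine Finset.sum_le_sum_of_subset_of_nonneg ?_ fun d _ _ =>
          mul_nonneg vonMangoldt_nonneg (Real.exp_pos _).le
        intro d hd; exact (Finset.mem_filter.1 hd).2
    _ = (∑ d ∈ Finset.Icc 1 ⌊Real.exp Z⌋₊, vonMangoldt d) * Real.exp (1 - Z) := by
        rw [Finset.sum_mul]
    _ ≤ ((Real.log 4 + 4) * Real.exp Z) * Real.exp (1 - Z) := by
        gcongr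
        refine (sum_vonMangoldt_le _).trans ?_
        gcongr
        exact Nat.floor_le (Real.exp_pos Z).le
    _ = (Real.log 4 + 4) * Real.exp 1 := by rw [mul_assoc, ← Real.exp_add]; ring_nf
    _ ≤ _ := by
        rw [mul_comm]
        gcongr
        exact Real.exp_one_lt_three.le

open MeasureTheory Set ArithmeticFunction in
/-- A logarithmic partial sum is controlled by its average over a logarithmic scale. -/
theorem norm_sum_mul_le_integral {h : ℕ → ℂ} (h0 : h 0 = 0)
    (hmul : ∀ m n, h (m * n) = h m * h n) (hb : ∀ n, ‖h n‖ ≤ 1 / n) {X : ℝ} (hX : 0 ≤ X) :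
    ‖∑ n ∈ Finset.Icc 1 ⌊Real.exp X⌋₊, h n‖ * X ≤ 3 * (X + (Real.log 4 + 4)) +
      (3 * (Real.log 4 + 4) + 1) *
        ∫ v in Icc 0 (X + 1), ‖∑ n ∈ Finset.Icc 1 ⌊Real.exp v⌋₊, h n‖ := by
  set K := Real.log 4 + 4 with hK
  set L : ℝ → ℂ := fun v => ∑ n ∈ Finset.Icc 1 ⌊Real.exp v⌋₊, h n with hL
  set N := ⌊Real.exp X⌋₊ with hN
  have hLi : IntegrableOn (fun v => ‖L v‖) (Icc 0 (X + 1)) := by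
    simpa using integrableOn_norm_sum_pow h (X + 1) 1
  -- The split X = log n + (X - log n): the first part goes through Λ, the second is the integral of
  -- L.
  have hdec : L X * (X : ℂ) = ∑ n ∈ Finset.Icc 1 N, h n * (Real.log n : ℂ) +
      ∑ n ∈ Finset.Icc 1 N, h n * ((X - Real.log n : ℝ) : ℂ) := by
    rw [hL, Finset.sum_mul, ← Finset.sum_add_distrib]
    refine Finset.sum_congr rfl fun n _ => ?_
    push_cast; ring
  have hpart2 : ‖∑ n ∈ Finset.Icc 1 N, h n * ((X - Real.log n : ℝ) : ℂ)‖ ≤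
      ∫ v in Icc 0 (X + 1), ‖L v‖ := by
    rw [hN, sum_mul_sub_log_eq_integral h X]
    refine (norm_integral_le_integral_norm _).trans ?_
    refine setIntegral_mono_set hLi (Filter.Eventually.of_forall fun v => norm_nonneg _) ?_
    exact (Icc_subset_Icc_right (by linarith)).eventuallyLE
  have hLd : ∀ d ∈ Finset.Icc 1 N, ∑ m ∈ Finset.Icc 1 (N / d), h m = L (X - Real.log d) ∧
      0 ≤ X - Real.log d := by
    intro d hd
    have hd' := Finset.mem_Icc.1 hd
    have hd0 : (0:ℝ) < d := by exact_mod_cast hd'.1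
    constructor
    · simp only [hL]
      rw [Real.exp_sub, Real.exp_log hd0, Nat.floor_div_natCast]
    · rw [sub_nonneg, Real.log_le_iff_le_exp hd0, ← Nat.le_floor_iff (Real.exp_pos X).le]
      exact hd'.2
  have hΛd : ∀ d : ℕ, 0 ≤ vonMangoldt d / d := fun d =>
    div_nonneg vonMangoldt_nonneg (Nat.cast_nonneg d)
  have hpart1 : ‖∑ n ∈ Finset.Icc 1 N, h n * (Real.log n : ℂ)‖ ≤ 3 * (X + K) +
      3 * K * ∫ v in Icc 0 (X + 1), ‖L v‖ := by
    rw [sum_mul_log_eq_sum_vonMangoldt h h0 hmul]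
    set ι : ℕ → ℝ → ℝ := fun d =>
      (Icc (X - Real.log d) (X - Real.log d + 1)).indicator (fun _ => (1:ℝ)) with hι
    have hιi : ∀ d, IntegrableOn (fun v => ι d v * ‖L v‖) (Icc 0 (X + 1)) := by
      intro d
      have : (fun v => ι d v * ‖L v‖) =
          (Icc (X - Real.log d) (X - Real.log d + 1)).indicator (fun v => ‖L v‖) := by
        funext v
        simp only [hι, indicator_apply]
        split_ifs <;> simp
      rw [this]
      exact hLi.indicator measurableSet_Icc
    have hterm : ∀ d ∈ Finset.Icc 1 N,
        ‖(vonMangoldt d : ℂ) * h d * ∑ m ∈ Finset.Icc 1 (N / d), h m‖ ≤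
        3 * (vonMangoldt d / d) + ∫ v in Icc 0 (X + 1), vonMangoldt d / d * (ι d v * ‖L v‖) := by
      intro d hd
      obtain ⟨e, hY⟩ := hLd d hd
      set Y := X - Real.log d with hYdef
      have hYX : Y + 1 ≤ X + 1 := by
        have := Real.log_natCast_nonneg d
        linarith
      have hmean : ‖L Y‖ ≤ 3 + ∫ v in Icc 0 (X + 1), ι d v * ‖L v‖ := by
        have e2 : ∫ v in Icc 0 (X + 1), ι d v * ‖L v‖ = ∫ v in Icc Y (Y + 1), ‖L v‖ := by
          have : (fun v => ι d v * ‖L v‖) =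
              (Icc Y (Y + 1)).indicator (fun v => ‖L v‖) := by
            funext v
            simp only [hι, indicator_apply]
            split_ifs <;> simp
          rw [this, setIntegral_indicator measurableSet_Icc,
            inter_eq_self_of_subset_right (Icc_subset_Icc hY hYX)]
        have h3 : ∫ v in Icc Y (Y + 1), ‖L Y‖ ≤ ∫ v in Icc Y (Y + 1), (3 + ‖L v‖) := by
          refine setIntegral_mono_on (integrable_const _) ?_ measurableSet_Icc fun v hv =>
            norm_sum_Icc_sub_le hb hv.1 hv.2
          exact (integrable_const _).add (hLi.mono_set (Icc_subset_Icc hY hYX))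
        rw [integral_add (integrable_const _) (hLi.mono_set (Icc_subset_Icc hY hYX)),
          setIntegral_const, setIntegral_const, Real.volume_real_Icc_of_le (by linarith)] at h3
        simp only [add_sub_cancel_left, one_smul] at h3
        rwa [e2]
      rw [e, norm_mul, norm_mul, Complex.norm_real, Real.norm_of_nonneg vonMangoldt_nonneg,
        integral_const_mul]
      calc vonMangoldt d * ‖h d‖ * ‖L Y‖ ≤ vonMangoldt d * (1 / d) * ‖L Y‖ := by
            have := vonMangoldt_nonneg (n := d)
            gcongr; exact hb d
        _ = vonMangoldt d / d * ‖L Y‖ := by ring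
        _ ≤ vonMangoldt d / d * (3 + ∫ v in Icc 0 (X + 1), ι d v * ‖L v‖) :=
            mul_le_mul_of_nonneg_left hmean (hΛd d)
        _ = _ := by ring
    refine (norm_sum_le_of_le _ hterm).trans ?_
    rw [Finset.sum_add_distrib, ← Finset.mul_sum, ← integral_finsetSum _
      (fun d _ => (hιi d).const_mul _)]
    have hM := sum_vonMangoldt_div_le (x := Real.exp X) (Real.one_le_exp hX)
    rw [Real.log_exp] at hM
    -- After the exchange of sum and integral, |L(v)| carries the total Λ-weight of the windows
    -- containing v, which is bounded.
    have hI : ∫ v in Icc 0 (X + 1), ∑ d ∈ Finset.Icc 1 N, vonMangoldt d / d * (ι d v * ‖L v‖) ≤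
        3 * K * ∫ v in Icc 0 (X + 1), ‖L v‖ := by
      rw [← integral_const_mul]
      refine integral_mono (integrable_finsetSum _ fun d _ => (hιi d).const_mul _)
        (hLi.const_mul _) fun v => ?_
      simp only [← mul_assoc, ← Finset.sum_mul]
      gcongr
      exact sum_vonMangoldt_div_indicator_le N X v
    gcongr
  calc ‖L X‖ * X = ‖L X * (X : ℂ)‖ := by
        rw [norm_mul, Complex.norm_real, Real.norm_of_nonneg hX]
    _ ≤ (3 * (X + K) + 3 * K * ∫ v in Icc 0 (X + 1), ‖L v‖) + ∫ v in Icc 0 (X + 1), ‖L v‖ := by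
        rw [hdec]
        exact (norm_add_le _ _).trans (add_le_add hpart1 hpart2)
    _ = _ := by ring

/-! ### Mean squares on vertical lines -/

theorem integrable_and_integral_one_div_sq_add_sq {α : ℝ} (hα : 0 < α) :
    MeasureTheory.Integrable (fun t : ℝ => 1 / (α ^ 2 + t ^ 2)) ∧
      ∫ t : ℝ, 1 / (α ^ 2 + t ^ 2) = Real.pi / α := by
  have e : (fun t : ℝ => 1 / (α ^ 2 + t ^ 2)) =
      fun t : ℝ => (α ^ 2)⁻¹ * (1 + (α⁻¹ * t) ^ 2)⁻¹ := by
    funext t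
    have : α ^ 2 + t ^ 2 ≠ 0 := by positivity
    have : 1 + (α⁻¹ * t) ^ 2 ≠ 0 := by positivity
    field_simp
  rw [e]
  refine ⟨((MeasureTheory.integrable_comp_mul_left_iff (fun t : ℝ => (1 + t ^ 2)⁻¹)
    (inv_ne_zero hα.ne')).2 integrable_inv_one_add_sq).const_mul _, ?_⟩
  rw [MeasureTheory.integral_const_mul,
    MeasureTheory.Measure.integral_comp_mul_left (fun t : ℝ => (1 + t ^ 2)⁻¹),
    integral_univ_inv_one_add_sq, inv_inv, abs_of_pos hα, smul_eq_mul]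
  field_simp

open MeasureTheory Set in
/-- The mean square of `F(s) / s` on the line `Re s = 1 + α` for coefficients bounded by `1`. -/
theorem integral_norm_LSeries_div_sq_le {f : ℕ → ℂ} (hf : ∀ n, ‖f n‖ ≤ 1) {α : ℝ} (hα : 0 < α) :
    Integrable (fun t : ℝ => ‖LSeries f ((1 + α : ℝ) + t * Complex.I) /
      ((1 + α : ℝ) + t * Complex.I)‖ ^ 2) ∧
    ∫ t : ℝ, ‖LSeries f ((1 + α : ℝ) + t * Complex.I) / ((1 + α : ℝ) + t * Complex.I)‖ ^ 2 ≤
      Real.pi / α := by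
  have hA : ∀ n : ℕ, ‖∑ k ∈ Finset.Icc 1 n, f k‖ ≤ n := by
    intro n
    refine (norm_sum_le_of_le _ fun k _ => hf k).trans ?_
    simp
  obtain ⟨h1, h2, h3⟩ := LSeries_plancherel f (c := 1) (r := 1) (σ := 1 + α) zero_le_one
    (by linarith) (fun n _ => by simpa using hA n)
    (LSeriesSummable_of_bounded_of_one_lt_re (m := 1) (fun n _ => hf n) (by simpa using hα))
  refine ⟨h1, ?_⟩
  rw [h3]
  have hb : ∫ v in Ioi (0 : ℝ), ‖∑ k ∈ Finset.Icc 1 ⌊Real.exp v⌋₊, f k‖ ^ 2 *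
      Real.exp (-(2 * (1 + α)) * v) ≤ ∫ v in Ioi (0 : ℝ), Real.exp (-(2 * α) * v) := by
    refine setIntegral_mono_on h2 (exp_neg_integrableOn_Ioi 0 (by linarith)) measurableSet_Ioi
      fun v _ => ?_
    calc _ ≤ Real.exp v ^ 2 * Real.exp (-(2 * (1 + α)) * v) := by
          gcongr
          exact (hA _).trans (Nat.floor_le (Real.exp_pos v).le)
      _ = _ := by
          rw [← Real.exp_nat_mul, ← Real.exp_add]; push_cast; ring_nf
  rw [integral_exp_mul_Ioi (by linarith : -(2 * α) < 0)] at hb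
  calc _ ≤ 2 * Real.pi * (-Real.exp (-(2 * α) * 0) / (-(2 * α))) := by gcongr
    _ = _ := by rw [mul_zero, Real.exp_zero]; field_simp

open MeasureTheory Set in
/-- The weighted mean square of the logarithmic partial sums, in terms of the maximum of the
Dirichlet series on a segment. -/
theorem integral_norm_sum_div_sq_le {f : ℕ → ℂ} (hf : ∀ n, ‖f n‖ ≤ 1) {α T B : ℝ} (hα : 0 < α)
    (hα2 : α ≤ 2) (hT : 0 < T) (hT1 : T ≤ 1)
    (hB : ∀ t : ℝ, |t| ≤ T → ‖LSeries f ((1 + α : ℝ) + t * Complex.I)‖ ≤ B) :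
    IntegrableOn (fun v : ℝ => ‖∑ k ∈ Finset.Icc 1 ⌊Real.exp v⌋₊, f k / (k : ℂ)‖ ^ 2 *
      Real.exp (-(2 * α) * v)) (Ioi 0) ∧
    ∫ v in Ioi (0 : ℝ), ‖∑ k ∈ Finset.Icc 1 ⌊Real.exp v⌋₊, f k / (k : ℂ)‖ ^ 2 *
      Real.exp (-(2 * α) * v) ≤ 5 / α * (B ^ 2 + (1 / T) ^ 2) := by
  have hb : ∀ n : ℕ, ‖f n / (n : ℂ)‖ ≤ 1 / n := by
    intro n
    rw [norm_div, Complex.norm_natCast]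
    gcongr
    exact hf n
  -- Plancherel at σ = α needs growth of exponent below α, so the logarithmic bound is weakened to
  -- n^{α/2}. The large constant is harmless: it does not enter the identity.
  have hA : ∀ n : ℕ, 1 ≤ n → ‖∑ k ∈ Finset.Icc 1 n, f k / (k : ℂ)‖ ≤
      (1 + 1 / (α / 2)) * (n : ℝ) ^ (α / 2) := by
    intro n hn
    have hn1 : (1:ℝ) ≤ n := by exact_mod_cast hn
    have hh := harmonic_le_one_add_log n
    rw [harmonic_eq_sum_Icc] at hh
    push_cast at hh
    have h1 := Real.log_le_rpow_div (x := n) (by linarith) (by linarith : 0 < α / 2)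
    have h2 : 1 ≤ (n : ℝ) ^ (α / 2) := Real.one_le_rpow hn1 (by linarith)
    refine (norm_sum_le_of_le _ fun k _ => hb k).trans ?_
    simp only [one_div] at hh ⊢
    calc _ ≤ _ := hh
      _ ≤ (n : ℝ) ^ (α / 2) + (n : ℝ) ^ (α / 2) / (α / 2) := add_le_add h2 h1
      _ = _ := by ring
  have hS : LSeriesSummable (fun k => f k / (k : ℂ)) α := by
    refine LSeriesSummable_of_le_const_mul_rpow (x := 0) (by simpa using hα) ⟨1, fun n _ => ?_⟩
    rw [zero_sub, Real.rpow_neg_one, one_mul, ← one_div]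
    exact hb n
  obtain ⟨h1, h2, h3⟩ := LSeries_plancherel (fun k => f k / (k : ℂ)) (σ := α)
    (by linarith : 0 ≤ α / 2) (by linarith) hA hS
  refine ⟨h2, ?_⟩
  have hL : ∀ t : ℝ, LSeries (fun k => f k / (k : ℂ)) (α + t * Complex.I) =
      LSeries f ((1 + α : ℝ) + t * Complex.I) := by
    intro t
    unfold LSeries
    congr 1; funext n
    rcases eq_or_ne n 0 with rfl | hn
    · simp
    · have hn0 : (n : ℂ) ≠ 0 := by exact_mod_cast hn
      rw [LSeries.term_of_ne_zero hn, LSeries.term_of_ne_zero hn, div_div]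
      congr 1
      rw [show ((1 + α : ℝ) : ℂ) + t * Complex.I = 1 + (α + t * Complex.I) by push_cast; ring,
        Complex.cpow_add 1 _ hn0, Complex.cpow_one]
  simp only [hL] at h1 h3
  obtain ⟨q1, q2⟩ := integral_norm_LSeries_div_sq_le hf hα
  obtain ⟨r1, r2⟩ := integrable_and_integral_one_div_sq_add_sq hα
  have hnorm : ∀ (z : ℂ) (a t : ℝ), ‖z / (a + t * Complex.I)‖ ^ 2 = ‖z‖ ^ 2 / (a ^ 2 + t ^ 2) := by
    intro z a t
    rw [norm_div, div_pow, ← Complex.normSq_eq_norm_sq (_ + _), Complex.normSq_add_mul_I]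
  have hpt : ∀ t : ℝ, ‖LSeries f ((1 + α : ℝ) + t * Complex.I) / (α + t * Complex.I)‖ ^ 2 ≤
      B ^ 2 * (1 / (α ^ 2 + t ^ 2)) + 10 * (1 / T) ^ 2 *
        ‖LSeries f ((1 + α : ℝ) + t * Complex.I) / ((1 + α : ℝ) + t * Complex.I)‖ ^ 2 := by
    intro t
    rw [hnorm, hnorm]
    set F := ‖LSeries f ((1 + α : ℝ) + t * Complex.I)‖
    have hF : 0 ≤ F := norm_nonneg _
    have hd : 0 < α ^ 2 + t ^ 2 := by positivity
    have hd1 : 0 < (1 + α) ^ 2 + t ^ 2 := by positivity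
    by_cases ht : |t| ≤ T
    · have : F ^ 2 / (α ^ 2 + t ^ 2) ≤ B ^ 2 * (1 / (α ^ 2 + t ^ 2)) := by
        rw [mul_one_div]
        gcongr
        exact hB t ht
      have h' : 0 ≤ 10 * (1 / T) ^ 2 * (F ^ 2 / ((1 + α) ^ 2 + t ^ 2)) := by positivity
      linarith
    · have hTt : T ^ 2 ≤ t ^ 2 := by
        rw [← sq_abs t]
        have := not_le.1 ht
        gcongr
      have hkey : T ^ 2 * ((1 + α) ^ 2 + t ^ 2) ≤ 10 * (α ^ 2 + t ^ 2) := by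
        have hT2 : T ^ 2 ≤ 1 := pow_le_one₀ hT.le hT1
        have e1 : T ^ 2 * (1 + α) ^ 2 ≤ t ^ 2 * 9 := by
          have : (1 + α) ^ 2 ≤ 9 := by nlinarith
          gcongr
        have e2 : T ^ 2 * t ^ 2 ≤ 1 * t ^ 2 := by gcongr
        nlinarith [sq_nonneg α]
      have : F ^ 2 / (α ^ 2 + t ^ 2) ≤ 10 * (1 / T) ^ 2 * (F ^ 2 / ((1 + α) ^ 2 + t ^ 2)) := by
        have e : 10 * (1 / T) ^ 2 * (F ^ 2 / ((1 + α) ^ 2 + t ^ 2)) =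
          10 * F ^ 2 / (T ^ 2 * ((1 + α) ^ 2 + t ^ 2)) := by field_simp
        rw [e, div_le_div_iff₀ hd (by positivity)]
        nlinarith [mul_le_mul_of_nonneg_left hkey (sq_nonneg F)]
      have h' : 0 ≤ B ^ 2 * (1 / (α ^ 2 + t ^ 2)) := by positivity
      linarith
  have hint := integral_mono h1 ((r1.const_mul (B ^ 2)).add (q1.const_mul (10 * (1 / T) ^ 2))) hpt
  rw [h3] at hint
  simp only [Pi.add_apply] at hint
  rw [integral_add (r1.const_mul _) (q1.const_mul _), integral_const_mul, integral_const_mul,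
    r2] at hint
  have hq : 10 * (1 / T) ^ 2 * (∫ t : ℝ, ‖LSeries f ((1 + α : ℝ) + t * Complex.I) /
      ((1 + α : ℝ) + t * Complex.I)‖ ^ 2) ≤ 10 * (1 / T) ^ 2 * (Real.pi / α) := by gcongr
  refine le_of_mul_le_mul_left (?_ : 2 * Real.pi * _ ≤ 2 * Real.pi * _) (by positivity)
  refine (hint.trans (add_le_add_right hq _)).trans ?_
  have : 0 ≤ B ^ 2 * (Real.pi / α) := by positivity
  calc _ ≤ 10 * B ^ 2 * (Real.pi / α) + 10 * (1 / T) ^ 2 * (Real.pi / α) := by linarith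
    _ = _ := by ring

open MeasureTheory Set in
theorem theorem1p4 :
    ∃ C : ℝ, 0 < C ∧ ∀ f : ℕ →*₀ ℂ, f ∈ classF → ∀ x : ℝ, 2 ≤ x → ∀ T : ℝ, 0 < T → T ≤ 1 →
      ‖∑ n ∈ Finset.Icc 1 ⌊x⌋₊, f n / (n : ℂ)‖ ≤
        C * (Real.log x * Real.exp (-minDistSq (fun n => f n) x T) + 1 / T) := by
  obtain ⟨C₀, hC₀, hF⟩ := norm_LSeries_le_log_mul_exp
  set K := Real.log 4 + 4 with hK
  have hK0 : 0 ≤ K := by have := Real.log_nonneg (by norm_num : (1:ℝ) ≤ 4); linarith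
  set C₁ := 3 * (1 + 2 * K) + (3 * K + 1) * ((5 * Real.exp 6 + 3) / 2) with hC₁
  have hC₁0 : 0 < C₁ := by positivity
  refine ⟨C₁ * (C₀ + 1), by positivity, fun f hf x hx T hT hT1 => ?_⟩
  set X := Real.log x with hXdef
  have hX0 : 0 < X := Real.log_pos (by linarith)
  have hα2 : 1 / X ≤ 2 := inv_log_le_two hx
  have hXhalf : 1 ≤ 2 * X := by rwa [div_le_iff₀ hX0] at hα2
  have hxX : Real.exp X = x := Real.exp_log (by linarith)
  set M := minDistSq (fun n => f n) x T with hM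
  set K₀ := C₀ * (X * Real.exp (-M)) with hK₀
  have hK₀0 : 0 ≤ K₀ := by positivity
  have hB : ∀ t : ℝ, |t| ≤ T →
      ‖LSeries (fun n => f n) ((1 + 1 / X : ℝ) + t * Complex.I)‖ ≤ K₀ := by
    intro t ht
    refine (hF f hf x hx t).trans ?_
    have hle : M ≤ pretDist (fun n => f n) (twist t) x ^ 2 :=
      (minDistSq_isLeast (fun n => f n) x hT.le).2 ⟨t, ht, rfl⟩
    rw [hK₀]
    gcongr
  obtain ⟨m1, m2⟩ := integral_norm_sum_div_sq_le (f := fun n => f n) hf (by positivity) hα2 hT hT1 hB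
  set L : ℝ → ℂ := fun v => ∑ k ∈ Finset.Icc 1 ⌊Real.exp v⌋₊, f k / (k : ℂ) with hL
  set B := K₀ + 1 / T with hBdef
  have hT1' : 1 ≤ 1 / T := by rw [le_div_iff₀ hT]; linarith
  have hB1 : 1 ≤ B := by linarith
  have hB0 : 0 < B := by linarith
  have hmain := norm_sum_mul_le_integral (h := fun n => f n / (n : ℂ)) (by simp)
    (fun m n => by rw [map_mul]; push_cast; rw [mul_div_mul_comm])
    (fun n => by
      rw [norm_div, Complex.norm_natCast]
      gcongr
      exact hf n) hX0.le
  have hi1 : IntegrableOn (fun v => ‖L v‖) (Icc 0 (X + 1)) := by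
    simpa using integrableOn_norm_sum_pow (fun n => f n / (n : ℂ)) (X + 1) 1
  have hi2 : IntegrableOn (fun v => ‖L v‖ ^ 2) (Icc 0 (X + 1)) :=
    integrableOn_norm_sum_pow (fun n => f n / (n : ℂ)) (X + 1) 2
  have hsq : ∫ v in Icc 0 (X + 1), ‖L v‖ ^ 2 ≤ Real.exp 6 * (5 * X * B ^ 2) := by
    rw [integral_Icc_eq_integral_Ioc]
    calc ∫ v in Ioc 0 (X + 1), ‖L v‖ ^ 2
        ≤ ∫ v in Ioc 0 (X + 1), Real.exp 6 * (‖L v‖ ^ 2 * Real.exp (-(2 * (1 / X)) * v)) := by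
          refine setIntegral_mono_on (hi2.mono_set Ioc_subset_Icc_self)
            ((m1.mono_set Ioc_subset_Ioi_self).const_mul _) measurableSet_Ioc fun v hv => ?_
          rw [mul_left_comm, ← Real.exp_add]
          refine le_mul_of_one_le_right (by positivity) (Real.one_le_exp ?_)
          have : 1 / X * v ≤ 1 / X * (X + 1) := by gcongr; exact hv.2
          have e : 1 / X * (X + 1) = 1 + 1 / X := by field_simp
          linarith
      _ ≤ ∫ v in Ioi 0, Real.exp 6 * (‖L v‖ ^ 2 * Real.exp (-(2 * (1 / X)) * v)) := by
          refine setIntegral_mono_set (m1.const_mul _)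
            (Filter.Eventually.of_forall fun v => by positivity) ?_
          exact Ioc_subset_Ioi_self.eventuallyLE
      _ ≤ Real.exp 6 * (5 * X * B ^ 2) := by
          rw [integral_const_mul]
          gcongr
          refine m2.trans ?_
          have e : 5 / (1 / X) = 5 * X := by field_simp
          rw [e]
          gcongr
          have : 0 ≤ K₀ * (1 / T) := by positivity
          rw [hBdef]; nlinarith
  have hlin : ∫ v in Icc 0 (X + 1), ‖L v‖ ≤ (5 * Real.exp 6 + 3) / 2 * (X * B) := by
    have h1 : ∫ v in Icc 0 (X + 1), ‖L v‖ ≤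
        ∫ v in Icc 0 (X + 1), ((2 * B)⁻¹ * ‖L v‖ ^ 2 + B / 2) := by
      refine integral_mono hi1 ((hi2.const_mul _).add (integrable_const _)) fun v => ?_
      have e : (2 * B)⁻¹ * ‖L v‖ ^ 2 + B / 2 - ‖L v‖ = (2 * B)⁻¹ * (‖L v‖ - B) ^ 2 := by
        field_simp; ring
      have : 0 ≤ (2 * B)⁻¹ * (‖L v‖ - B) ^ 2 := by positivity
      linarith
    rw [integral_add (hi2.const_mul _) (integrable_const _), integral_const_mul, setIntegral_const,
      Real.volume_real_Icc_of_le (by linarith), smul_eq_mul] at h1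
    calc _ ≤ _ := h1
      _ ≤ (2 * B)⁻¹ * (Real.exp 6 * (5 * X * B ^ 2)) + (3 * X) * (B / 2) := by
          gcongr
          linarith
      _ = _ := by field_simp
  rw [hxX] at hmain
  set S := ‖∑ n ∈ Finset.Icc 1 ⌊x⌋₊, f n / (n : ℂ)‖ with hS
  have hfin : S * X ≤ C₁ * B * X := by
    calc S * X ≤ 3 * (X + K) + (3 * K + 1) * ((5 * Real.exp 6 + 3) / 2 * (X * B)) := by
          refine hmain.trans ?_
          gcongr
      _ ≤ 3 * (X * (1 + 2 * K)) * B + (3 * K + 1) * ((5 * Real.exp 6 + 3) / 2 * (X * B)) := by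
          have h1 : X + K ≤ X * (1 + 2 * K) := by nlinarith
          have h2 : X * (1 + 2 * K) ≤ X * (1 + 2 * K) * B :=
            le_mul_of_one_le_right (by positivity) hB1
          linarith
      _ = _ := by rw [hC₁]; ring
  have hSB : S ≤ C₁ * B := le_of_mul_le_mul_right hfin hX0
  refine hSB.trans ?_
  rw [mul_assoc]
  gcongr
  have h1 : 0 ≤ X * Real.exp (-M) := by positivity
  have h2 : 0 ≤ C₀ * (1 / T) := by positivity
  rw [hBdef, hK₀]
  nlinarith
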